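/- For a finite simple graph $G$ and $\alpha\in[0,1)$ let $A_\alpha(G)=\alpha D(G)+(1-\alpha)A(G)$, where $D(G)$ is the diagonal matrix of vertex degrees and $A(G)$ the adjacency matrix; put $\beta=1-\alpha$. Let $R$ be a connected graph on $r$ vertices $v_1,\dots,v_r$, and let $\rho_1,\dots,\rho_r$ be the eigenvalues of $A_\alpha(R)$, counted with multiplicity, where $\rho_1$ is the spectral radius. Let $B_k$ be a generalized Bethe tree on $k$ levels, i.e. a finite rooted tree in which vertices at the same level (one more than the distance from the root) have the same degree, $k$ being the largest level. For $1\le j\le k$ let $n_j$ and $d_j$ be the number and the degree of the vertices at level $k-j+1$. Let $R\{B_k\}$ be the graph obtained from $R$ and $r$ copies of $B_k$ by identifying the root of the $i$-th copy with $v_i$. Let $T_k$ be the $k\times k$ symmetric tridiagonal matrix with diagonal $\alpha,\alpha d_2,\dots,\alpha d_k$ and codiagonal $\beta\sqrt{d_2-1},\dots,\beta\sqrt{d_{k-1}-1},\beta\sqrt{d_k}$ (for $k=1$, the $1\times1$ matrix $(\alpha d_1)=(0)$). For $1\le j\le k-1$ let $T_j$ be its $j\times j$ leading principal submatrix, and for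 $1\le i\le r$ let $S_i$ be the $k\times k$ matrix obtained from $T_k$ by adding $\rho_i$ to the last diagonal entry. Then: (1) As sets, $$\mathrm{Spec}(A_\alpha(R\{B_k\}))=\Bigl(\bigcup_{1\le j\le k-1,\ n_j>n_{j+1}}\mathrm{Spec}(T_j)\Bigr)\cup\Bigl(\bigcup_{i=1}^r\mathrm{Spec}(S_i)\Bigr).$$ (2) The eigenvalues of each $T_j$ ($1\le j\le k-1$) and of each $S_i$ ($1\le i\le r$) are simple eigenvalues of that matrix. As eigenvalues of $A_\alpha(R\{B_k\})$, each eigenvalue of $T_j$ has multiplicity $r(n_j-n_{j+1})$ and each eigenvalue of $S_i$ has multiplicity $1$, where multiplicities are added whenever eigenvalues obtained from different matrices are equal. That is, for every real $x$, with $\mathrm{mult}_M(x)$ denoting the multiplicity of $x$ as an eigenvalue of $M$ (zero if it is not one), $$\mathrm{mult}_{A_\alpha(R\{B_k\})}(x)=\sum_{j=1}^{k-1}r(n_j-n_{j+1})\,\mathrm{mult}_{T_j}(x)+\sum_{i=1}^r\mathrm{mult}_{S_i}(x).$$ (3) The largest eigenvalue of $S_1$ is the spectral radius of $A_\alpha(R\{B_k\})$.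 -/

import Mathlib

/-- The matrix `A_α(G) = α D(G) + (1 - α) A(G)`. -/
noncomputable def alphaMatrix {V : Type*} [Fintype V] [DecidableEq V] (G : SimpleGraph V)
    [DecidableRel G.Adj] (α : ℝ) : Matrix V V ℝ :=
  α • G.degMatrix ℝ + (1 - α) • G.adjMatrix ℝ

/-- The graph `R{H}`: one copy of `H` for every vertex `x` of `R`, the root `o` of that copy being
identified with `x`. The vertex `(x, u)` is the vertex `u` of the copy of `H` at `x`, so that
`(x, o)` is the vertex `x` of `R`. -/
def copiesGraph {V W : Type*} (R : SimpleGraph V) (H : SimpleGraph W) (o : W) :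
    SimpleGraph (V × W) where
  Adj p q := (p.1 = q.1 ∧ H.Adj p.2 q.2) ∨ (p.2 = o ∧ q.2 = o ∧ R.Adj p.1 q.1)
  symm := ⟨by
    rintro p q (⟨h1, h2⟩ | ⟨h1, h2, h3⟩)
    · exact Or.inl ⟨h1.symm, h2.symm⟩
    · exact Or.inr ⟨h2, h1, h3.symm⟩⟩
  loopless := ⟨by
    rintro p (⟨_, h⟩ | ⟨_, _, h⟩)
    · exact H.irrefl h
    · exact R.irrefl h⟩

instance copiesGraphDecidableAdj {V W : Type*} [DecidableEq V] [DecidableEq W] (R : SimpleGraph V) (H : SimpleGraph W)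
    (o : W) [DecidableRel R.Adj] [DecidableRel H.Adj] : DecidableRel (copiesGraph R H o).Adj :=
  fun p q => inferInstanceAs
    (Decidable ((p.1 = q.1 ∧ H.Adj p.2 q.2) ∨ (p.2 = o ∧ q.2 = o ∧ R.Adj p.1 q.1)))

/-- The level of a vertex of a rooted graph: one more than its distance from the root. -/
noncomputable def rootLevel {W : Type*} (H : SimpleGraph W) (o v : W) : ℕ := H.dist o v + 1

/-- `B` with root `o` is a generalized Bethe tree on `k` levels: a rooted tree in which vertices at
the same level have the same degree, and `k` is the largest level of a vertex. -/
structure IsGeneralizedBetheTree {W : Type*} [Fintype W] (B : SimpleGraph W) [DecidableRel B.Adj]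
    (o : W) (k : ℕ) : Prop where
  isTree : B.IsTree
  degree_eq : ∀ u v : W, rootLevel B o u = rootLevel B o v → B.degree u = B.degree v
  level_le : ∀ v : W, rootLevel B o v ≤ k
  exists_level : ∃ v : W, rootLevel B o v = k

/-- The vertices at level `k - j + 1`, that is, on the `j`-th level counted from the bottom. -/
noncomputable def bottomLevel {W : Type*} [Fintype W] (B : SimpleGraph W) (o : W) (k j : ℕ) :
    Finset W :=
  Finset.univ.filter fun v => rootLevel B o v + j = k + 1

/-- `n_j`: the number of vertices at level `k - j + 1`. -/
noncomputable def betheNum {W : Type*} [Fintype W] (B : SimpleGraph W) (o : W) (k j : ℕ) : ℕ :=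
  (bottomLevel B o k j).card

/-- `d_j`: the common degree of the vertices at level `k - j + 1` (the supremum of a function that
is constant on a generalized Bethe tree). -/
noncomputable def betheDeg {W : Type*} [Fintype W] (B : SimpleGraph W) [DecidableRel B.Adj]
    (o : W) (k j : ℕ) : ℕ :=
  (bottomLevel B o k j).sup fun v => B.degree v

/-- The diagonal of the tridiagonal matrix `T_k`, with rows numbered from `0`: it is
`α, α d_2, …, α d_k`. If `k = 1` then the only entry is the last one, `α d_k`. -/
noncomputable def betheDiag {W : Type*} [Fintype W] (B : SimpleGraph W) [DecidableRel B.Adj]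
    (o : W) (k : ℕ) (α : ℝ) (a : ℕ) : ℝ :=
  if a = 0 ∧ 1 < k then α else α * (betheDeg B o k (a + 1) : ℝ)

/-- The entry in rows and columns `a`, `a + 1` (numbered from `0`) of the codiagonal of `T_k`: the
codiagonal is `β √(d_2 - 1), …, β √(d_{k-1} - 1), β √d_k` with `β = 1 - α`. -/
noncomputable def betheCodiag {W : Type*} [Fintype W] (B : SimpleGraph W) [DecidableRel B.Adj]
    (o : W) (k : ℕ) (α : ℝ) (a : ℕ) : ℝ :=
  if a + 2 = k then (1 - α) * √(betheDeg B o k k : ℝ)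
  else (1 - α) * √((betheDeg B o k (a + 2) : ℝ) - 1)

/-- For `j ≤ k`, the `j × j` leading principal submatrix `T_j` of the symmetric tridiagonal matrix
`T_k`. -/
noncomputable def betheT {W : Type*} [Fintype W] (B : SimpleGraph W) [DecidableRel B.Adj]
    (o : W) (k : ℕ) (α : ℝ) (j : ℕ) : Matrix (Fin j) (Fin j) ℝ :=
  Matrix.of fun a b =>
    if (a : ℕ) = b then betheDiag B o k α a
    else if (a : ℕ) + 1 = b then betheCodiag B o k α a
    else if (b : ℕ) + 1 = a then betheCodiag B o k α b
    else 0

/-- The `k × k` matrix `T_k` with `ρ` added to its last diagonal entry. -/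
noncomputable def betheS {W : Type*} [Fintype W] (B : SimpleGraph W) [DecidableRel B.Adj]
    (o : W) (k : ℕ) (α ρ : ℝ) : Matrix (Fin k) (Fin k) ℝ :=
  betheT B o k α k +
    Matrix.of fun a b : Fin k => if (a : ℕ) + 1 = k ∧ (b : ℕ) + 1 = k then ρ else 0

/-- The (algebraic) multiplicity of `x` as an eigenvalue of `M`; it is `0` if `x` is not an
eigenvalue. -/
noncomputable def eigMult {ι : Type*} [Fintype ι] [DecidableEq ι] (M : Matrix ι ι ℝ) (x : ℝ) : ℕ :=
  M.charpoly.rootMultiplicity x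

/-! With `E` the matrix unit at the root `o`, `A_α(R{B}) = 1 ⊗ A_α(B) + A_α(R) ⊗ E`
(`alphaMatrix_copiesGraph`). Gaussian elimination of `x - A_α(R{B})` from the leaves of the copies
towards their roots produces no fill-in, since every vertex has a single parent. By the degree
condition the pivot depends only on the level, and the pivots `t_0, t_1, …` satisfy the recursion of
the pivots of `x - T_k`. At the roots the block `t_{k-1} - A_α(R)` remains, so the determinant is
`∏_{a<k-1} t_a ^ (r n_{a+1}) · ∏_i (t_{k-1} - ρ_i)` (`det_copies`, `eval_charpoly_copiesGraph`).

On the other side, `det (x - T_j) = t_0 ⋯ t_{j-1}`, and for `S_i` the last factor becomes `t_{k-1} -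
ρ_i`. As `n_k = 1`, telescoping the exponents turns the determinant into `∏_j det (x - T_j) ^ (r
(n_j - n_{j+1})) · ∏_i det (x - S_i)`. This holds wherever the pivots divided by are nonzero, hence
as an identity of polynomials (`charpoly_copiesGraph`), which gives (1) and the multiplicities.

Simplicity holds because an eigenvector of a tridiagonal matrix with nonzero codiagonal is
determined by its first coordinate. For (3), the entries of every `T_j` and `S_i` are dominated in
absolute value by those of `S_1` or of a principal submatrix of it, so comparing quadratic forms at
`|v|` bounds all eigenvalues by the largest one of `S_1`. -/

section

open Matrix Polynomial
open scoped Kronecker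

/-- The symmetric tridiagonal `n × n` matrix with diagonal `d` and codiagonal `c`. -/
noncomputable def tridiag (d c : ℕ → ℝ) (n : ℕ) : Matrix (Fin n) (Fin n) ℝ :=
  Matrix.of fun a b =>
    if (a : ℕ) = b then d a
    else if (a : ℕ) + 1 = b then c a
    else if (b : ℕ) + 1 = a then c b
    else 0

/-- The pivots of the Gaussian elimination of `x - tridiag d c n`. -/
noncomputable def pivot (d c : ℕ → ℝ) (x : ℝ) : ℕ → ℝ
  | 0 => x - d 0
  | a + 1 => x - d (a + 1) - c a ^ 2 / pivot d c x a

/-! ### Gaussian elimination along a rooted forest -/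

section Forest

variable {W : Type*} [Fintype W] [DecidableEq W]

/-- The elimination matrix of a weighted rooted forest with pivots `s`. -/
noncomputable def elimMatrix (C : Matrix W W ℝ) (s : W → ℝ) : Matrix W W ℝ :=
  1 - Matrix.of fun v u => C v u / s v

/-- Nonzero entries of `C` strictly raise `h`, so the matrix is block triangular for `h` with
identity diagonal blocks. -/
theorem elimMatrix_det (C : Matrix W W ℝ) (s : W → ℝ) (h : W → ℕ)
    (hC : ∀ v u, C v u ≠ 0 → h v < h u) : (elimMatrix C s).det = 1 := by
  have hz : ∀ v u, h u ≤ h v → C v u = 0 := fun v u huv => by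
    by_contra hne
    exact absurd (hC v u hne) (by omega)
  have hb : (elimMatrix C s).BlockTriangular h := by
    intro i j hij
    have : i ≠ j := by rintro rfl; exact lt_irrefl _ hij
    simp [elimMatrix, this, hz i j hij.le]
  rw [hb.det]
  refine Finset.prod_eq_one fun a _ => ?_
  have : (elimMatrix C s).toSquareBlock h a = 1 := by
    ext ⟨i, hi⟩ ⟨j, hj⟩
    simp [elimMatrix, Matrix.toSquareBlock_def, hz i j (by omega), Matrix.one_apply]
  rw [this, det_one]

/-- An entry `C v u` is the weight of the edge from `v` to its parent `u`. As parents are unique,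
eliminating `v` changes only the diagonal entry of its parent: `Eᵀ * C` is diagonal. Only pivots of
vertices with a parent are divided by, so the pivot of a root may vanish. -/
theorem elimMatrix_factorization (C : Matrix W W ℝ) (s a : W → ℝ)
    (huniq : ∀ v u u', C v u ≠ 0 → C v u' ≠ 0 → u = u')
    (hs0 : ∀ v u, C v u ≠ 0 → s v ≠ 0)
    (hs : ∀ u, s u = a u - ∑ v, C v u ^ 2 / s v) :
    (elimMatrix C s)ᵀ * diagonal s * elimMatrix C s = diagonal a - C - Cᵀ := by
  set E : Matrix W W ℝ := Matrix.of fun v u => C v u / s v with hE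
  have h1 : diagonal s * E = C := by
    ext v u
    rw [diagonal_mul, hE, of_apply]
    by_cases hc : C v u = 0
    · simp [hc]
    · have := hs0 v u hc
      field_simp
  have h2 : Eᵀ * diagonal s = Cᵀ := by
    rw [← h1, transpose_mul, diagonal_transpose]
  have h3 : Eᵀ * C = diagonal fun u => ∑ v, C v u ^ 2 / s v := by
    ext u u'
    rw [mul_apply, diagonal_apply]
    split_ifs with huu
    · subst huu
      refine Finset.sum_congr rfl fun v _ => ?_
      simp [hE]
      ring
    · refine Finset.sum_eq_zero fun v _ => ?_
      by_contra hne
      have hl := left_ne_zero_of_mul hne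
      have hr := right_ne_zero_of_mul hne
      refine huu (huniq v u u' (fun h0 => hl ?_) hr)
      simp [hE, h0]
  have h4 : diagonal s = diagonal a - diagonal fun u => ∑ v, C v u ^ 2 / s v := by
    rw [diagonal_sub]
    exact congrArg diagonal (funext hs)
  have : (elimMatrix C s)ᵀ * diagonal s * elimMatrix C s
      = diagonal s - diagonal s * E - Eᵀ * diagonal s + Eᵀ * (diagonal s * E) := by
    rw [elimMatrix, transpose_sub, transpose_one]
    noncomm_ring
  rw [this, h1, h2, h3, h4]
  abel

/-- The root has no parent, so row `o` of the elimination matrix is a unit vector and elimination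
leaves a perturbation at the root untouched. -/
theorem elimMatrix_conj_single (C : Matrix W W ℝ) (s : W → ℝ) (o : W) (ho : ∀ u, C o u = 0) :
    (elimMatrix C s)ᵀ * Matrix.single o o 1 * elimMatrix C s = Matrix.single o o 1 := by
  have h1 : Matrix.single o o (1 : ℝ) * elimMatrix C s = Matrix.single o o 1 := by
    ext i j
    rw [mul_apply, Finset.sum_eq_single o]
    · by_cases hi : o = i
      · subst hi
        simp [elimMatrix, Matrix.single_apply, ho, Matrix.one_apply]
      · simp [hi]
    · intro b _ hb
      simp [hb.symm]
    · simp
  have h2 := congrArg Matrix.transpose h1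
  rw [transpose_mul, transpose_single] at h2
  rw [h2, h1]

/-- The determinant obtained by attaching copies of a weighted rooted tree to a graph. -/
theorem det_copies {V : Type*} [Fintype V] [DecidableEq V] (N : Matrix V V ℝ)
    (C : Matrix W W ℝ) (s a : W → ℝ) (h : W → ℕ) (o : W)
    (hC : ∀ v u, C v u ≠ 0 → h v < h u)
    (huniq : ∀ v u u', C v u ≠ 0 → C v u' ≠ 0 → u = u')
    (hs0 : ∀ v u, C v u ≠ 0 → s v ≠ 0)
    (hs : ∀ u, s u = a u - ∑ v, C v u ^ 2 / s v) (ho : ∀ u, C o u = 0) :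
    ((1 : Matrix V V ℝ) ⊗ₖ (diagonal a - C - Cᵀ) - N ⊗ₖ Matrix.single o o (1 : ℝ)).det =
      (∏ w ∈ Finset.univ.erase o, s w ^ Fintype.card V) * N.charpoly.eval (s o) := by
  set U := elimMatrix C s with hU
  have hdet : U.det = 1 := elimMatrix_det C s h hC
  -- Eliminating in all copies at once leaves one `V × V` block per tree vertex: the scalar `s w`
  -- away from the root, and `s o - N` at the root.
  have hfac : (1 : Matrix V V ℝ) ⊗ₖ (diagonal a - C - Cᵀ) - N ⊗ₖ Matrix.single o o (1 : ℝ) =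
      ((1 : Matrix V V ℝ) ⊗ₖ Uᵀ) * blockDiagonal
        (fun w => Matrix.scalar V (s w) - if w = o then N else 0) * ((1 : Matrix V V ℝ) ⊗ₖ U) := by
    have hb : blockDiagonal (fun w => Matrix.scalar V (s w) - if w = o then N else 0) =
        (1 : Matrix V V ℝ) ⊗ₖ diagonal s - N ⊗ₖ Matrix.single o o (1 : ℝ) := by
      ext ⟨i, w⟩ ⟨j, w'⟩
      by_cases hw : w = w'
      · subst hw
        by_cases hwo : w = o
        · subst hwo
          by_cases hij : i = j <;> simp [blockDiagonal_apply, kroneckerMap_apply, hij]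
        · have how : ¬ o = w := fun h => hwo h.symm
          by_cases hij : i = j <;>
            simp [blockDiagonal_apply, kroneckerMap_apply, hwo, how, hij]
      · have : ¬ (o = w ∧ o = w') := fun h => hw (h.1.symm.trans h.2)
        simp [blockDiagonal_apply, kroneckerMap_apply, hw, this]
    rw [hb, mul_sub, sub_mul, ← mul_kronecker_mul, ← mul_kronecker_mul, ← mul_kronecker_mul,
      ← mul_kronecker_mul]
    simp only [one_mul, mul_one]
    rw [hU,
      elimMatrix_factorization C s a huniq hs0 hs, elimMatrix_conj_single C s o ho]
  rw [hfac, det_mul, det_mul, det_kronecker, det_kronecker, det_transpose, hdet,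
    det_blockDiagonal]
  simp only [det_one, one_pow, one_mul, mul_one]
  rw [← Finset.mul_prod_erase _ _ (Finset.mem_univ o), mul_comm]
  congr 1
  · refine Finset.prod_congr rfl fun w hw => ?_
    rw [if_neg (Finset.ne_of_mem_erase hw), sub_zero, scalar_apply, det_diagonal,
      Finset.prod_const, Finset.card_univ]
  · rw [if_pos rfl, eval_charpoly]

end Forest

/-! ### Tridiagonal matrices: pivots and simple eigenvalues -/

theorem eval_charpoly_tridiag (d c : ℕ → ℝ) (n : ℕ) (x : ℝ)
    (hp : ∀ a, a + 1 < n → pivot d c x a ≠ 0) :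
    (tridiag d c n).charpoly.eval x = ∏ a ∈ Finset.range n, pivot d c x a := by
  -- The path is a rooted tree in which `a + 1` is the parent of `a`.
  set C : Matrix (Fin n) (Fin n) ℝ := Matrix.of fun a b => if (a : ℕ) + 1 = b then c a else 0
    with hCdef
  have hC : ∀ v u, C v u ≠ 0 → (v : ℕ) + 1 = u := fun v u hvu => by
    by_contra hne
    simp [hCdef, hne] at hvu
  have hfac := elimMatrix_factorization C (fun a => pivot d c x a) (fun a => x - d a)
    (fun v u u' h1 h2 => Fin.ext ((hC v u h1).symm.trans (hC v u' h2)))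
    (fun v u hvu => hp v (by have := hC v u hvu; omega)) (by
      rintro ⟨u, hu⟩
      cases u with
      | zero => simp [pivot, hCdef]
      | succ u =>
        rw [Finset.sum_eq_single ⟨u, by omega⟩]
        · simp [pivot, hCdef]
        · intro b _ hb
          have : (b : ℕ) ≠ u := fun h => hb (Fin.ext h)
          simp [hCdef, this]
        · simp)
  have hx : Matrix.scalar (Fin n) x - tridiag d c n =
      diagonal (fun a : Fin n => x - d a) - C - Cᵀ := by
    ext a b
    by_cases hab : a = b
    · subst hab
      simp [tridiag, hCdef]
    · have hne : (a : ℕ) ≠ b := fun h => hab (Fin.ext h)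
      by_cases h1 : (a : ℕ) + 1 = b
      · have : ¬ ((b : ℕ) + 1 = a) := by omega
        simp [tridiag, hCdef, hab, hne, h1, this]
      · by_cases h2 : (b : ℕ) + 1 = a <;> simp [tridiag, hCdef, hab, hne, h1, h2]
  rw [eval_charpoly, hx, ← hfac, det_mul, det_mul, det_transpose,
    elimMatrix_det C _ (fun a => (a : ℕ)) (fun v u hvu => by have := hC v u hvu; omega),
    det_diagonal, one_mul, mul_one, Finset.prod_range]

theorem tridiag_isHermitian (d c : ℕ → ℝ) (n : ℕ) : (tridiag d c n).IsHermitian := by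
  ext a b
  simp only [tridiag, conjTranspose_apply, of_apply, star_trivial]
  split_ifs <;> first | rfl | omega | (congr 1)

/-- An eigenvector of a tridiagonal matrix with nonzero codiagonal is determined by its first
coordinate. -/
theorem tridiag_eigenvector_eq_zero (d c : ℕ → ℝ) (n : ℕ) (hc : ∀ a, a + 1 < n → c a ≠ 0)
    (x : ℝ) (v : Fin n → ℝ) (hv : tridiag d c n *ᵥ v = x • v)
    (h0 : ∀ h : 0 < n, v ⟨0, h⟩ = 0) : v = 0 := by
  have key : ∀ a, ∀ h : a < n, v ⟨a, h⟩ = 0 := by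
    intro a
    induction a using Nat.strong_induction_on with
    | _ a ih =>
      intro h
      cases a with
      | zero => exact h0 h
      | succ a =>
        -- In row `a`, the coordinates up to `a` vanish and the entries beyond column `a + 1` are
        -- zero, so only `c a * v (a + 1)` survives.
        have hrow := congrFun hv ⟨a, by omega⟩
        rw [mulVec, dotProduct, Finset.sum_eq_single ⟨a + 1, h⟩] at hrow
        · simp [tridiag, ih a (by omega) (by omega)] at hrow
          exact hrow.resolve_left (hc a h)
        · rintro ⟨b, hb⟩ _ hne
          have hne' : b ≠ a + 1 := fun h => hne (Fin.ext h)
          rcases Nat.lt_or_ge b (a + 1) with hlt | hge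
          · rw [ih b hlt hb, mul_zero]
          · have h1 : a ≠ b := by omega
            have h2 : a + 1 ≠ b := by omega
            have h3 : b + 1 ≠ a := by omega
            simp [tridiag, h1, h2, h3]
        · simp
  exact funext fun a => key a a.2

/-- Eigenvalues of a tridiagonal matrix with nonzero codiagonal are simple. -/
theorem tridiag_rootMultiplicity (d c : ℕ → ℝ) (n : ℕ) (hc : ∀ a, a + 1 < n → c a ≠ 0)
    (x : ℝ) (hx : x ∈ spectrum ℝ (tridiag d c n)) :
    (tridiag d c n).charpoly.rootMultiplicity x = 1 := by
  have hM := tridiag_isHermitian d c n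
  set M := tridiag d c n with hMdef
  have hinj : ∀ i j, hM.eigenvalues i = hM.eigenvalues j → i = j := by
    intro i j hij
    by_contra hne
    have hn : 0 < n := i.pos
    set p : Fin n → ℝ := ⇑(hM.eigenvectorBasis i) with hpdef
    set q : Fin n → ℝ := ⇑(hM.eigenvectorBasis j) with hqdef
    have hp : M *ᵥ p = hM.eigenvalues i • p := hM.mulVec_eigenvectorBasis i
    have hq : M *ᵥ q = hM.eigenvalues i • q := by rw [hij]; exact hM.mulVec_eigenvectorBasis j
    have hlin := hM.eigenvectorBasis.toBasis.linearIndependent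
    have hpair : LinearIndependent ℝ ![hM.eigenvectorBasis i, hM.eigenvectorBasis j] := by
      have := hlin.comp ![i, j] (by
        intro a b hab
        fin_cases a <;> fin_cases b <;> simp_all)
      have he : ⇑hM.eigenvectorBasis.toBasis ∘ ![i, j] =
          ![hM.eigenvectorBasis i, hM.eigenvectorBasis j] := by
        ext a
        fin_cases a <;> simp
      rwa [he] at this
    rw [LinearIndependent.pair_iff] at hpair
    -- Two eigenvectors for one eigenvalue have a combination with first coordinate zero, which must
    -- vanish.
    have hcomb : q ⟨0, hn⟩ • p - p ⟨0, hn⟩ • q = 0 := by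
      refine tridiag_eigenvector_eq_zero d c n hc (hM.eigenvalues i) _ ?_ ?_
      · rw [mulVec_sub, mulVec_smul, mulVec_smul, ← hMdef, hp, hq, smul_sub, smul_comm,
          smul_comm (p ⟨0, hn⟩)]
      · intro h
        simp [mul_comm]
    have h2 := hpair (q ⟨0, hn⟩) (-p ⟨0, hn⟩) (by
      ext a
      have := congrFun hcomb a
      simpa [sub_eq_add_neg] using this)
    have hp0 : p = 0 := tridiag_eigenvector_eq_zero d c n hc _ p hp
      (fun _ => neg_eq_zero.mp h2.2)
    exact hM.eigenvectorBasis.toBasis.ne_zero i (by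
      ext a
      simpa using congrFun hp0 a)
  rw [hM.spectrum_real_eq_range_eigenvalues] at hx
  obtain ⟨i, rfl⟩ := hx
  rw [← count_roots, hM.roots_charpoly_eq_eigenvalues]
  refine Multiset.count_eq_one_of_mem ?_ (Multiset.mem_map_of_mem _ (Finset.mem_univ_val i))
  exact (Multiset.nodup_map_iff_inj_on Finset.univ.nodup).2
    (fun a _ b _ hab => hinj a b (by simpa using hab))

/-! ### Parents, children and levels in a generalized Bethe tree -/

section Tree

variable {W : Type*} {B : SimpleGraph W} {o : W}

theorem SimpleGraph.IsTree.exists_adj_dist_add_one (hB : B.IsTree) {v : W} (hv : v ≠ o) :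
    ∃ u, B.Adj v u ∧ B.dist o v = B.dist o u + 1 := by
  obtain ⟨p, hp⟩ := hB.connected.exists_walk_length_eq_dist v o
  cases p with
  | nil => exact absurd rfl hv
  | cons h q =>
    rename_i w
    refine ⟨w, h, ?_⟩
    have h1 := SimpleGraph.dist_le q
    rw [SimpleGraph.Walk.length_cons, SimpleGraph.dist_comm] at hp
    rw [SimpleGraph.dist_comm] at h1
    have := hB.dist_eq_dist_add_one_of_adj o h
    omega

/-- Geodesics to `u` and `u'`, extended by `v`, are both the unique path from `o` to `v`, so their
penultimate vertices agree. -/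
theorem SimpleGraph.IsTree.eq_of_adj_dist_add_one (hB : B.IsTree) {v u u' : W}
    (h1 : B.Adj v u) (hd1 : B.dist o v = B.dist o u + 1)
    (h2 : B.Adj v u') (hd2 : B.dist o v = B.dist o u' + 1) : u = u' := by
  have key : ∀ w, B.Adj v w → B.dist o v = B.dist o w + 1 →
      ∃ p : B.Walk o w, ∃ h : B.Adj w v, (p.concat h).IsPath := by
    intro w hw hd
    obtain ⟨p, hp, hlen⟩ := (hB.connected o w).exists_path_of_dist
    refine ⟨p, hw.symm, hp.concat (fun hmem => ?_) _⟩
    classical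
    have := SimpleGraph.dist_le (p.takeUntil v hmem)
    have := p.length_takeUntil_le_length hmem
    omega
  obtain ⟨p, hp, hpp⟩ := key u h1 hd1
  obtain ⟨q, hq, hqq⟩ := key u' h2 hd2
  have heq : p.concat hp = q.concat hq := (hB.existsUnique_path o v).unique hpp hqq
  have := congrArg SimpleGraph.Walk.penultimate heq
  simpa using this

variable [Fintype W] {k : ℕ}

theorem mem_bottomLevel {j : ℕ} {v : W} : v ∈ bottomLevel B o k j ↔ B.dist o v + j = k := by
  rw [bottomLevel, Finset.mem_filter, rootLevel]
  simp only [Finset.mem_univ, true_and]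
  omega

variable [DecidableRel B.Adj]

/-- The neighbours of `u` that are farther from the root `o`. -/
noncomputable def childFinset (B : SimpleGraph W) [DecidableRel B.Adj] (o u : W) : Finset W :=
  Finset.univ.filter fun v => B.Adj v u ∧ B.dist o v = B.dist o u + 1

theorem card_childFinset [DecidableEq W] (hB : B.IsTree) (u : W) :
    B.degree u = (childFinset B o u).card + if u = o then 0 else 1 := by
  rw [← SimpleGraph.card_neighborFinset_eq_degree]
  split_ifs with hu
  · subst hu
    rw [add_zero]
    congr 1
    ext v
    simp only [SimpleGraph.mem_neighborFinset, childFinset, Finset.mem_filter, Finset.mem_univ,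
      true_and]
    refine ⟨fun h => ⟨h.symm, ?_⟩, fun h => h.1.symm⟩
    have := hB.dist_eq_dist_add_one_of_adj u h
    rw [SimpleGraph.dist_self] at this ⊢
    omega
  · obtain ⟨w, hw, hd⟩ := hB.exists_adj_dist_add_one hu
    have hn : w ∉ childFinset B o u := by
      simp only [childFinset, Finset.mem_filter, not_and]
      intros
      omega
    rw [← Finset.card_insert_of_notMem hn]
    congr 1
    ext v
    simp only [SimpleGraph.mem_neighborFinset, childFinset, Finset.mem_insert, Finset.mem_filter,
      Finset.mem_univ, true_and]
    constructor
    · intro h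
      rcases hB.dist_eq_dist_add_one_of_adj o h with h1 | h1
      · exact Or.inl (hB.eq_of_adj_dist_add_one h h1 hw hd)
      · exact Or.inr ⟨h.symm, h1⟩
    · rintro (rfl | h)
      · exact hw
      · exact h.1.symm

namespace IsGeneralizedBetheTree

theorem dist_lt (h : IsGeneralizedBetheTree B o k) (v : W) : B.dist o v < k := h.level_le v

theorem exists_dist_eq (h : IsGeneralizedBetheTree B o k) {d : ℕ} (hd : d < k) :
    ∃ v, B.dist o v = d := by
  obtain ⟨m, rfl⟩ : ∃ m, k = m + 1 := ⟨k - 1, by omega⟩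
  induction hn : m - d generalizing d with
  | zero =>
    obtain ⟨v, hv⟩ := h.exists_level
    rw [rootLevel] at hv
    exact ⟨v, by omega⟩
  | succ n ih =>
    obtain ⟨v, hv⟩ := ih (d := d + 1) (by omega) (by omega)
    have hvo : v ≠ o := by
      rintro rfl
      simp at hv
    obtain ⟨u, -, hu⟩ := h.isTree.exists_adj_dist_add_one hvo
    exact ⟨u, by omega⟩

theorem card_childFinset_eq (h : IsGeneralizedBetheTree B o k) {u v : W}
    (huv : B.dist o u = B.dist o v) : (childFinset B o u).card = (childFinset B o v).card := by
  classical
  have h1 := card_childFinset (o := o) h.isTree u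
  have h2 := card_childFinset (o := o) h.isTree v
  have h3 := h.degree_eq u v (by rw [rootLevel, rootLevel, huv])
  have h4 : u = o ↔ v = o := by
    rw [← eq_comm, ← (h.isTree.connected).dist_eq_zero_iff, huv,
      (h.isTree.connected).dist_eq_zero_iff, eq_comm]
  simp only [h4] at h1
  omega

theorem childFinset_nonempty (h : IsGeneralizedBetheTree B o k) {u : W}
    (hu : B.dist o u + 1 < k) : (childFinset B o u).Nonempty := by
  obtain ⟨v, hv⟩ := h.exists_dist_eq hu
  have hvo : v ≠ o := by
    rintro rfl
    simp at hv
  obtain ⟨w, hw, hd⟩ := h.isTree.exists_adj_dist_add_one hvo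
  rw [← Finset.card_pos, h.card_childFinset_eq (u := u) (v := w) (by omega), Finset.card_pos]
  exact ⟨v, by simp [childFinset, hw, hd]⟩

theorem childFinset_eq_empty (h : IsGeneralizedBetheTree B o k) {u : W}
    (hu : B.dist o u + 1 = k) : childFinset B o u = ∅ := by
  refine Finset.filter_eq_empty_iff.2 fun v _ hv => ?_
  have := h.dist_lt v
  omega

theorem betheDeg_eq (h : IsGeneralizedBetheTree B o k) {j : ℕ} {v : W}
    (hv : B.dist o v + j = k) : betheDeg B o k j = B.degree v := by
  apply le_antisymm
  · refine Finset.sup_le fun w hw => (h.degree_eq w v ?_).le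
    rw [mem_bottomLevel] at hw
    simp only [rootLevel]
    omega
  · exact Finset.le_sup (f := fun v => B.degree v) (mem_bottomLevel.2 hv)

/-- The exceptional entry `α` is that of a leaf of degree 1; for `k = 1` the bottom vertex is the
root, of degree 0. -/
theorem betheDiag_eq (h : IsGeneralizedBetheTree B o k) (α : ℝ) {a : ℕ} {v : W}
    (hv : B.dist o v + a + 1 = k) : betheDiag B o k α a = α * B.degree v := by
  classical
  have hd := h.betheDeg_eq (j := a + 1) (v := v) (by omega)
  rw [betheDiag]
  split_ifs with ha
  · have hvo : v ≠ o := by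
      rintro rfl
      rw [SimpleGraph.dist_self] at hv
      omega
    rw [card_childFinset (o := o) h.isTree v, h.childFinset_eq_empty (by omega), if_neg hvo]
    simp
  · rw [hd]

/-- Both square roots are taken of the number of children: the full degree at the root, one less
elsewhere. -/
theorem betheCodiag_sq (h : IsGeneralizedBetheTree B o k) (α : ℝ) {a : ℕ} {u : W}
    (hu : B.dist o u + a + 2 = k) :
    betheCodiag B o k α a ^ 2 = (childFinset B o u).card * (1 - α) ^ 2 := by
  classical
  have hc := card_childFinset (o := o) h.isTree u
  rw [betheCodiag]
  split_ifs with ha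
  · have huo : u = o := by
      rw [eq_comm, ← (h.isTree.connected).dist_eq_zero_iff]
      omega
    rw [h.betheDeg_eq (v := u) (by omega), mul_pow, Real.sq_sqrt (by positivity), hc, if_pos huo]
    simp [mul_comm]
  · have huo : u ≠ o := by
      rintro rfl
      rw [SimpleGraph.dist_self] at hu
      omega
    rw [h.betheDeg_eq (v := u) (by omega), hc, if_neg huo, Nat.cast_add, Nat.cast_one,
      add_sub_cancel_right, mul_pow, Real.sq_sqrt (by positivity), mul_comm]

theorem betheCodiag_ne_zero (h : IsGeneralizedBetheTree B o k) {α : ℝ} (hα : α < 1) {a : ℕ}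
    (ha : a + 1 < k) : betheCodiag B o k α a ≠ 0 := by
  obtain ⟨u, hu⟩ := h.exists_dist_eq (d := k - a - 2) (by omega)
  have hsq := h.betheCodiag_sq α (a := a) (u := u) (by omega)
  have hne := (h.childFinset_nonempty (u := u) (by omega)).card_pos
  have : (0 : ℝ) < (childFinset B o u).card * (1 - α) ^ 2 :=
    mul_pos (by exact_mod_cast hne) (pow_pos (by linarith) 2)
  rw [← hsq] at this
  exact fun h0 => by simp [h0] at this

/-- Choosing a child of each vertex is injective, since a child determines its parent. -/
theorem betheNum_succ_le (h : IsGeneralizedBetheTree B o k) {j : ℕ} (hj : 1 ≤ j) :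
    betheNum B o k (j + 1) ≤ betheNum B o k j := by
  have hex : ∀ u ∈ bottomLevel B o k (j + 1), ∃ v, v ∈ childFinset B o u := fun u hu => by
    rw [mem_bottomLevel] at hu
    exact h.childFinset_nonempty (by omega)
  choose! f hf using hex
  refine Finset.card_le_card_of_injOn f (fun u hu => ?_) (fun u hu u' hu' huu => ?_)
  · have h1 := hf u hu
    rw [Finset.mem_coe, mem_bottomLevel] at hu ⊢
    simp only [childFinset, Finset.mem_filter, Finset.mem_univ, true_and] at h1
    omega
  · have h1 := hf u hu
    have h2 := hf u' hu'
    rw [← huu] at h2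
    simp only [childFinset, Finset.mem_filter, Finset.mem_univ, true_and] at h1 h2
    exact h.isTree.eq_of_adj_dist_add_one h1.1 h1.2 h2.1 h2.2

theorem betheNum_top (h : IsGeneralizedBetheTree B o k) : betheNum B o k k = 1 := by
  rw [betheNum, Finset.card_eq_one]
  refine ⟨o, ?_⟩
  ext v
  rw [mem_bottomLevel, Finset.mem_singleton, eq_comm (a := v),
    ← (h.isTree.connected).dist_eq_zero_iff]
  omega

end IsGeneralizedBetheTree

end Tree

theorem SimpleGraph.degree_eq_sum_adjMatrix {V : Type*} [Fintype V] [DecidableEq V]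
    (G : SimpleGraph V) [DecidableRel G.Adj] (v : V) :
    (G.degree v : ℝ) = ∑ w, G.adjMatrix ℝ v w := by
  have h := G.adjMatrix_mulVec_const_apply (α := ℝ) (a := 1) (v := v)
  rw [mul_one] at h
  rw [← h]
  simp [mulVec, dotProduct]

/-- The exponent of `t a` on the left is `∑_{j=a+1}^{m} (n j - n (j+1)) + n (m+1)`, which
telescopes. -/
theorem prod_pow_sub_telescope (t : ℕ → ℝ) (n : ℕ → ℕ) (m : ℕ)
    (hn : ∀ j, 1 ≤ j → j ≤ m → n (j + 1) ≤ n j) :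
    (∏ j ∈ Finset.Ico 1 (m + 1), (∏ a ∈ Finset.range j, t a) ^ (n j - n (j + 1))) *
      (∏ a ∈ Finset.range m, t a) ^ n (m + 1) = ∏ a ∈ Finset.range m, t a ^ n (a + 1) := by
  induction m with
  | zero => simp
  | succ m ih =>
    rw [Finset.prod_Ico_succ_top (by omega), mul_assoc, ← pow_add,
      Nat.sub_add_cancel (hn (m + 1) (by omega) le_rfl), Finset.prod_range_succ, mul_pow,
      ← mul_assoc, ih fun j h1 h2 => hn j h1 (by omega), Finset.prod_range_succ]

/-! ### Kronecker form of the matrix of `R{B}` -/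

section Copies

variable {V W : Type*} [DecidableEq V] [DecidableEq W]
  (R : SimpleGraph V) [DecidableRel R.Adj] (B : SimpleGraph W) [DecidableRel B.Adj] (o : W)

theorem adjMatrix_copiesGraph : (copiesGraph R B o).adjMatrix ℝ =
    (1 : Matrix V V ℝ) ⊗ₖ B.adjMatrix ℝ + R.adjMatrix ℝ ⊗ₖ Matrix.single o o (1 : ℝ) := by
  ext ⟨x, w⟩ ⟨y, w'⟩
  rw [Matrix.add_apply, kroneckerMap_apply, kroneckerMap_apply, SimpleGraph.adjMatrix_apply,
    SimpleGraph.adjMatrix_apply, SimpleGraph.adjMatrix_apply, Matrix.single_apply,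
    Matrix.one_apply]
  simp only [copiesGraph]
  by_cases hxy : x = y
  · subst hxy
    by_cases hw : B.Adj w w' <;> simp [hw]
  · by_cases hr : R.Adj x y <;> simp [hxy, hr, eq_comm]

variable [Fintype V] [Fintype W]

theorem degree_copiesGraph (x : V) (w : W) : ((copiesGraph R B o).degree (x, w) : ℝ) =
    B.degree w + if w = o then (R.degree x : ℝ) else 0 := by
  rw [SimpleGraph.degree_eq_sum_adjMatrix, adjMatrix_copiesGraph, Fintype.sum_prod_type]
  simp only [Matrix.add_apply, kroneckerMap_apply, Finset.sum_add_distrib]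
  congr 1
  · rw [Finset.sum_eq_single x, SimpleGraph.degree_eq_sum_adjMatrix]
    · simp
    · intro y _ hy
      simp [hy.symm]
    · simp
  · rw [SimpleGraph.degree_eq_sum_adjMatrix]
    simp only [← Finset.mul_sum]
    rw [← Finset.sum_mul]
    by_cases hw : w = o
    · subst hw
      simp [Matrix.single_apply]
    · simp [hw, Ne.symm hw]

theorem alphaMatrix_copiesGraph (α : ℝ) : alphaMatrix (copiesGraph R B o) α =
    (1 : Matrix V V ℝ) ⊗ₖ alphaMatrix B α + alphaMatrix R α ⊗ₖ Matrix.single o o (1 : ℝ) := by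
  have hdeg : (copiesGraph R B o).degMatrix ℝ =
      (1 : Matrix V V ℝ) ⊗ₖ B.degMatrix ℝ + R.degMatrix ℝ ⊗ₖ Matrix.single o o (1 : ℝ) := by
    ext ⟨x, w⟩ ⟨y, w'⟩
    simp only [SimpleGraph.degMatrix, Matrix.add_apply, kroneckerMap_apply, Matrix.single_apply,
      Matrix.one_apply, diagonal_apply, degree_copiesGraph, Prod.mk.injEq]
    by_cases hxy : x = y
    · by_cases hw : w = w'
      · subst hw
        by_cases hwo : w = o
        · simp [hxy, hwo]
        · simp [hxy, hwo, Ne.symm hwo]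
      · have : ¬ (o = w ∧ o = w') := fun h => hw (h.1.symm.trans h.2)
        simp [hxy, hw, this]
    · simp [hxy]
  simp only [alphaMatrix, hdeg, adjMatrix_copiesGraph, kronecker_add, add_kronecker,
    smul_add, kronecker_smul, smul_kronecker]
  abel

end Copies

/-! ### Factorization of the characteristic polynomial -/

section Factorization

variable {W : Type*} [Fintype W]
  {B : SimpleGraph W} [DecidableRel B.Adj] {o : W} {k : ℕ}

theorem betheT_eq_tridiag (α : ℝ) (j : ℕ) :
    betheT B o k α j = tridiag (betheDiag B o k α) (betheCodiag B o k α) j := rfl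

/-- The diagonal of `betheS`. -/
noncomputable def betheSDiag (B : SimpleGraph W) [DecidableRel B.Adj] (o : W) (k : ℕ) (α ρ : ℝ)
    (a : ℕ) : ℝ :=
  betheDiag B o k α a + if a + 1 = k then ρ else 0

theorem betheS_eq_tridiag (α ρ : ℝ) :
    betheS B o k α ρ = tridiag (betheSDiag B o k α ρ) (betheCodiag B o k α) k := by
  ext a b
  rw [betheS, betheT_eq_tridiag, Matrix.add_apply]
  simp only [tridiag, of_apply, betheSDiag]
  by_cases hab : (a : ℕ) = b
  · simp [hab]
  · have : ¬ ((a : ℕ) + 1 = k ∧ (b : ℕ) + 1 = k) := by omega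
    simp [hab, this]

/-- Pivot `a` only sees diagonal entries up to `a`, so `ρ` enters at the last pivot alone. -/
theorem pivot_betheSDiag (α ρ x : ℝ) (a : ℕ) (ha : a < k) :
    pivot (betheSDiag B o k α ρ) (betheCodiag B o k α) x a =
      pivot (betheDiag B o k α) (betheCodiag B o k α) x a - if a + 1 = k then ρ else 0 := by
  induction a with
  | zero =>
    simp only [pivot, betheSDiag]
    ring
  | succ a ih =>
    have hne : a + 1 ≠ k := by omega
    simp only [pivot, betheSDiag]
    rw [ih (by omega), if_neg hne, sub_zero]
    ring

variable {V : Type*} [Fintype V] [DecidableEq V] [DecidableEq W]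
  {R : SimpleGraph V} [DecidableRel R.Adj]

theorem eval_charpoly_copiesGraph (hB : IsGeneralizedBetheTree B o k) (α x : ℝ)
    (hp : ∀ a, a + 1 < k → pivot (betheDiag B o k α) (betheCodiag B o k α) x a ≠ 0) :
    (alphaMatrix (copiesGraph R B o) α).charpoly.eval x =
      (∏ a ∈ Finset.range (k - 1), pivot (betheDiag B o k α) (betheCodiag B o k α) x a ^
        (Fintype.card V * betheNum B o k (a + 1))) *
      (alphaMatrix R α).charpoly.eval
        (pivot (betheDiag B o k α) (betheCodiag B o k α) x (k - 1)) := by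
  set t := pivot (betheDiag B o k α) (betheCodiag B o k α) x with ht
  set C : Matrix W W ℝ := Matrix.of fun v u =>
    if B.Adj v u ∧ B.dist o v = B.dist o u + 1 then 1 - α else 0 with hCdef
  have hC : ∀ v u, C v u ≠ 0 → B.Adj v u ∧ B.dist o v = B.dist o u + 1 := fun v u hvu => by
    by_contra hne
    rw [hCdef, of_apply, if_neg hne] at hvu
    exact hvu rfl
  have hmat : Matrix.scalar (V × W) x - alphaMatrix (copiesGraph R B o) α =
      (1 : Matrix V V ℝ) ⊗ₖ (diagonal (fun w => x - α * B.degree w) - C - Cᵀ) -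
        alphaMatrix R α ⊗ₖ Matrix.single o o (1 : ℝ) := by
    have h1 : diagonal (fun w => x - α * B.degree w) - C - Cᵀ =
        Matrix.scalar W x - alphaMatrix B α := by
      ext v u
      by_cases hvu : v = u
      · subst hvu
        simp [hCdef, alphaMatrix, SimpleGraph.degMatrix]
      · by_cases hadj : B.Adj v u
        · have hadj' := hadj.symm
          rcases hB.isTree.dist_eq_dist_add_one_of_adj o hadj with h | h
          · have : B.dist o u ≠ B.dist o v + 1 := by omega
            simp [hCdef, alphaMatrix, SimpleGraph.degMatrix, hvu, hadj, hadj', ← h, this]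
          · have : B.dist o v ≠ B.dist o u + 1 := by omega
            simp [hCdef, alphaMatrix, SimpleGraph.degMatrix, hvu, hadj, hadj', ← h, this]
        · have hadj' : ¬ B.Adj u v := fun h => hadj h.symm
          simp [hCdef, alphaMatrix, SimpleGraph.degMatrix, hvu, hadj, hadj']
    have h2 : Matrix.scalar (V × W) x = (1 : Matrix V V ℝ) ⊗ₖ Matrix.scalar W x := by
      ext ⟨i, w⟩ ⟨j, w'⟩
      by_cases hij : i = j <;> by_cases hw : w = w' <;> simp [hij, hw]
    have h3 : (1 : Matrix V V ℝ) ⊗ₖ Matrix.scalar W x =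
        (1 : Matrix V V ℝ) ⊗ₖ (Matrix.scalar W x - alphaMatrix B α) +
          (1 : Matrix V V ℝ) ⊗ₖ alphaMatrix B α := by
      rw [← kronecker_add, sub_add_cancel]
    rw [h1, h2, h3, alphaMatrix_copiesGraph]
    abel
  -- A vertex at distance `d` from the root receives pivot number `k - 1 - d`, counted from the
  -- bottom level.
  rw [eval_charpoly, hmat, det_copies (alphaMatrix R α) C (fun w => t (k - 1 - B.dist o w)) _
    (fun w => k - 1 - B.dist o w) o]
  · simp only [SimpleGraph.dist_self, Nat.sub_zero]
    congr 1
    rw [← Finset.prod_fiberwise_of_maps_to (s := Finset.univ.erase o) (t := Finset.range (k - 1))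
      (g := fun w => k - 1 - B.dist o w)]
    · refine Finset.prod_congr rfl fun a ha => ?_
      rw [Finset.mem_range] at ha
      have hset : (Finset.univ.erase o).filter (fun w => k - 1 - B.dist o w = a) =
          bottomLevel B o k (a + 1) := by
        ext w
        have := hB.dist_lt w
        rw [Finset.mem_filter, mem_bottomLevel, Finset.mem_erase]
        constructor
        · rintro ⟨-, h⟩
          omega
        · intro h
          refine ⟨⟨?_, Finset.mem_univ _⟩, by omega⟩
          rintro rfl
          rw [SimpleGraph.dist_self] at h
          omega
      rw [Finset.prod_congr rfl fun w hw => by rw [(Finset.mem_filter.1 hw).2], hset,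
        Finset.prod_const, ← pow_mul, betheNum]
    · intro w hw
      have h1 := hB.dist_lt w
      have h2 : B.dist o w ≠ 0 := fun h0 => (Finset.mem_erase.1 hw).1
        ((hB.isTree.connected).dist_eq_zero_iff.1 h0).symm
      simp only [Finset.mem_range]
      omega
  · intro v u hvu
    have := (hC v u hvu).2
    have := hB.dist_lt v
    omega
  · intro v u u' h1 h2
    exact hB.isTree.eq_of_adj_dist_add_one (hC v u h1).1 (hC v u h1).2 (hC v u' h2).1
      (hC v u' h2).2
  · intro v u hvu
    refine hp _ ?_
    have := (hC v u hvu).2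
    have := hB.dist_lt v
    omega
  · intro u
    have hu := hB.dist_lt u
    -- All children of `u` have the same pivot, so their total contribution is the `c ^ 2 / t` term
    -- of the tridiagonal recursion.
    have hsum : ∑ v, C v u ^ 2 / t (k - 1 - B.dist o v) =
        ∑ v ∈ childFinset B o u, (1 - α) ^ 2 / t (k - 1 - (B.dist o u + 1)) := by
      rw [childFinset, Finset.sum_filter]
      refine Finset.sum_congr rfl fun v _ => ?_
      rw [hCdef, of_apply]
      split_ifs with h
      · rw [h.2]
      · simp
    rw [hsum]
    obtain ⟨a, ha⟩ : ∃ a, a = k - 1 - B.dist o u := ⟨_, rfl⟩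
    rw [← ha, ← hB.betheDiag_eq α (a := a) (v := u) (by omega)]
    cases a with
    | zero =>
      rw [hB.childFinset_eq_empty (by omega), Finset.sum_empty, sub_zero, ht, pivot]
    | succ a =>
      have : k - 1 - (B.dist o u + 1) = a := by omega
      rw [this, ht, pivot, hB.betheCodiag_sq α (a := a) (u := u) (by omega), Finset.sum_const,
        nsmul_eq_mul, mul_div_assoc]
  · intro u
    by_contra hne
    have := (hC o u hne).2
    simp at this

theorem charpoly_copiesGraph (hB : IsGeneralizedBetheTree B o k) (α : ℝ) {r : ℕ}
    (hr : Fintype.card V = r) (ρ : Fin r → ℝ)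
    (hρ : (alphaMatrix R α).charpoly = ∏ i, (X - C (ρ i))) :
    (alphaMatrix (copiesGraph R B o) α).charpoly =
      (∏ j ∈ Finset.Ico 1 k, (betheT B o k α j).charpoly ^
        (r * (betheNum B o k j - betheNum B o k (j + 1)))) *
      ∏ i, (betheS B o k α (ρ i)).charpoly := by
  obtain ⟨m, rfl⟩ : ∃ m, k = m + 1 := ⟨k - 1, by have := hB.dist_lt o; omega⟩
  have hne : ∏ j ∈ Finset.Ico 1 (m + 1), (betheT B o (m + 1) α j).charpoly ≠ 0 :=
    Finset.prod_ne_zero_iff.2 fun j _ => (charpoly_monic _).ne_zero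
  -- The extra factor makes both sides vanish at the points where a needed pivot could be zero.
  refine mul_right_cancel₀ hne (Polynomial.funext fun x => ?_)
  rw [eval_mul, eval_mul]
  by_cases hx : (∏ j ∈ Finset.Ico 1 (m + 1), (betheT B o (m + 1) α j).charpoly).eval x = 0
  · rw [hx, mul_zero, mul_zero]
  congr 1
  set t := pivot (betheDiag B o (m + 1) α) (betheCodiag B o (m + 1) α) x with ht
  rw [eval_prod, ← ne_eq, Finset.prod_ne_zero_iff] at hx
  -- Once the earlier pivots are nonzero, `det (x - T_{a+1}) = t_0 ⋯ t_a`, so its nonvanishing gives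
  -- `t a ≠ 0`.
  have hp : ∀ a, a + 1 < m + 1 → t a ≠ 0 := by
    intro a
    induction a using Nat.strong_induction_on with
    | _ a ih =>
      intro ha
      have h := hx (a + 1) (Finset.mem_Ico.2 ⟨by omega, ha⟩)
      rw [betheT_eq_tridiag, eval_charpoly_tridiag _ _ _ _
        (fun b hb => ih b (by omega) (by omega)), Finset.prod_ne_zero_iff] at h
      exact h a (Finset.self_mem_range_succ a)
  have hT : ∀ j ∈ Finset.Ico 1 (m + 1), (betheT B o (m + 1) α j).charpoly.eval x =
      ∏ a ∈ Finset.range j, t a := by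
    intro j hj
    rw [Finset.mem_Ico] at hj
    rw [betheT_eq_tridiag, eval_charpoly_tridiag _ _ _ _ (fun b hb => hp b (by omega))]
  have hS : ∀ i, (betheS B o (m + 1) α (ρ i)).charpoly.eval x =
      (∏ a ∈ Finset.range m, t a) * (t m - ρ i) := by
    intro i
    rw [betheS_eq_tridiag, eval_charpoly_tridiag, Finset.prod_range_succ,
      pivot_betheSDiag _ _ _ _ (by omega), if_pos rfl]
    · congr 1
      refine Finset.prod_congr rfl fun a ha => ?_
      rw [Finset.mem_range] at ha
      rw [pivot_betheSDiag _ _ _ _ (by omega), if_neg (by omega), sub_zero]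
    · intro a ha
      rw [pivot_betheSDiag _ _ _ _ (by omega), if_neg (by omega), sub_zero]
      exact hp a ha
  have htel := prod_pow_sub_telescope t (betheNum B o (m + 1)) m
    (fun j h1 _ => hB.betheNum_succ_le h1)
  rw [hB.betheNum_top, pow_one] at htel
  rw [eval_charpoly_copiesGraph hB α x hp, eval_mul, eval_prod, eval_prod, hρ, eval_prod, hr]
  simp only [eval_pow, hS, eval_sub, eval_X, eval_C]
  have hTpow : ∏ j ∈ Finset.Ico 1 (m + 1), (betheT B o (m + 1) α j).charpoly.eval x ^
        (r * (betheNum B o (m + 1) j - betheNum B o (m + 1) (j + 1))) =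
      ∏ j ∈ Finset.Ico 1 (m + 1), (∏ a ∈ Finset.range j, t a) ^
        (r * (betheNum B o (m + 1) j - betheNum B o (m + 1) (j + 1))) :=
    Finset.prod_congr rfl fun j hj => by rw [hT j hj]
  rw [hTpow, Finset.prod_mul_distrib, Finset.prod_const, Finset.card_univ, Fintype.card_fin,
    ← mul_assoc]
  congr 1
  simp only [mul_comm r, pow_mul, Finset.prod_pow, Nat.add_sub_cancel]
  rw [← mul_pow, htel]

end Factorization

/-! ### Root multiplicities and comparison of spectra -/

theorem rootMultiplicity_prod {ι : Type*} (s : Finset ι) (f : ι → ℝ[X])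
    (hf : ∀ i ∈ s, f i ≠ 0) (x : ℝ) :
    (∏ i ∈ s, f i).rootMultiplicity x = ∑ i ∈ s, (f i).rootMultiplicity x := by
  rw [← count_roots, roots_prod _ _ (Finset.prod_ne_zero_iff.2 hf), Multiset.count_bind,
    Finset.sum]
  simp only [count_roots]

theorem rootMultiplicity_pow' (p : ℝ[X]) (n : ℕ) (x : ℝ) :
    (p ^ n).rootMultiplicity x = n * p.rootMultiplicity x := by
  rw [← count_roots, roots_pow, Multiset.count_nsmul, count_roots]

theorem mem_spectrum_iff_eigMult_pos {ι : Type*} [Fintype ι] [DecidableEq ι] (M : Matrix ι ι ℝ)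
    (x : ℝ) : x ∈ spectrum ℝ M ↔ 0 < eigMult M x := by
  rw [mem_spectrum_iff_isRoot_charpoly, eigMult, rootMultiplicity_pos (charpoly_monic M).ne_zero]

theorem posSemidef_smul_one_sub {ι : Type*} [Fintype ι] [DecidableEq ι] {M : Matrix ι ι ℝ}
    (hM : M.IsHermitian) {μ : ℝ} (h : ∀ y ∈ spectrum ℝ M, y ≤ μ) :
    (algebraMap ℝ (Matrix ι ι ℝ) μ - M).PosSemidef := by
  have hH : (algebraMap ℝ (Matrix ι ι ℝ) μ - M).IsHermitian := by
    refine IsHermitian.sub ?_ hM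
    rw [Algebra.algebraMap_eq_smul_one]
    simp [IsHermitian]
  rw [hH.posSemidef_iff_eigenvalues_nonneg]
  intro i
  have hi := hH.eigenvalues_mem_spectrum_real i
  rw [← spectrum.singleton_sub_eq, Set.singleton_sub] at hi
  obtain ⟨y, hy, hyi⟩ := hi
  have := h y hy
  simp only [Pi.zero_apply]
  rw [← hyi]
  linarith

/-- Domination of eigenvalues by an entrywise majorant. -/
theorem abs_le_of_mem_spectrum_of_abs_le {ι : Type*} [Fintype ι] [DecidableEq ι]
    {M N : Matrix ι ι ℝ} {μ x : ℝ} (hM : (algebraMap ℝ (Matrix ι ι ℝ) μ - M).PosSemidef)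
    (hN : ∀ i j, |N i j| ≤ M i j) (hx : x ∈ spectrum ℝ N) : |x| ≤ μ := by
  rw [← spectrum_toLin', ← Module.End.hasEigenvalue_iff_mem_spectrum] at hx
  obtain ⟨v, hv⟩ := hx.exists_hasEigenvector
  have hv0 := hv.2
  have hvx : N *ᵥ v = x • v := by simpa using hv.apply_eq_smul
  -- With `w = |v|`: `|x| (v ⬝ v) = |v ⬝ N v| ≤ w ⬝ M w ≤ μ (w ⬝ w) = μ (v ⬝ v)`.
  set w : ι → ℝ := fun i => |v i| with hw
  have hww : v ⬝ᵥ v = w ⬝ᵥ w := by simp [dotProduct, hw]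
  have hpos : 0 < v ⬝ᵥ v := by
    refine lt_of_le_of_ne (Finset.sum_nonneg fun i _ => mul_self_nonneg (v i)) (Ne.symm ?_)
    rwa [Ne, dotProduct_self_eq_zero]
  have h1 : |x| * (v ⬝ᵥ v) ≤ w ⬝ᵥ (M *ᵥ w) := by
    have : |x| * (v ⬝ᵥ v) = |v ⬝ᵥ (N *ᵥ v)| := by
      rw [hvx, dotProduct_smul, smul_eq_mul, abs_mul, abs_of_pos hpos]
    rw [this]
    simp only [dotProduct, mulVec, Finset.mul_sum]
    refine (Finset.abs_sum_le_sum_abs _ _).trans (Finset.sum_le_sum fun i _ =>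
      (Finset.abs_sum_le_sum_abs _ _).trans (Finset.sum_le_sum fun j _ => ?_))
    rw [abs_mul, abs_mul]
    exact mul_le_mul_of_nonneg_left
      (mul_le_mul_of_nonneg_right (hN i j) (abs_nonneg _)) (abs_nonneg _)
  have h2 := hM.dotProduct_mulVec_nonneg w
  rw [star_trivial, sub_mulVec, dotProduct_sub, Algebra.algebraMap_eq_smul_one, smul_mulVec,
    one_mulVec, dotProduct_smul, smul_eq_mul, ← hww] at h2
  exact le_of_mul_le_mul_right (by linarith) hpos

theorem spectralRadius_eq_ofReal {A : Type*} [Ring A] [Algebra ℝ A] {a : A} {μ : ℝ}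
    (hμ : μ ∈ spectrum ℝ a) (h : ∀ x ∈ spectrum ℝ a, |x| ≤ μ) :
    spectralRadius ℝ a = ENNReal.ofReal μ := by
  have hnn : ∀ x : ℝ, (‖x‖₊ : ENNReal) = ENNReal.ofReal |x| := fun x => by
    rw [← Real.norm_eq_abs, ofReal_norm, enorm_eq_nnnorm]
  refine le_antisymm (iSup₂_le fun x hx => ?_) ?_
  · rw [hnn]
    exact ENNReal.ofReal_le_ofReal (h x hx)
  · refine le_trans ?_ (le_iSup₂ (f := fun x (_ : x ∈ spectrum ℝ a) => (‖x‖₊ : ENNReal)) μ hμ)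
    rw [hnn]
    exact ENNReal.ofReal_le_ofReal (le_abs_self μ)

theorem abs_le_of_spectralRadius_eq {A : Type*} [Ring A] [Algebra ℝ A] {a : A} {μ : ℝ}
    (hμ : μ ∈ spectrum ℝ a) (h : spectralRadius ℝ a = ENNReal.ofReal μ) {x : ℝ}
    (hx : x ∈ spectrum ℝ a) : |x| ≤ μ := by
  -- `ENNReal.ofReal` truncates at zero, hence the second alternative; the case `y = μ` then yields
  -- `0 ≤ μ`.
  have key : ∀ y ∈ spectrum ℝ a, |y| ≤ μ ∨ |y| ≤ 0 := fun y hy => by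
    have := le_iSup₂ (f := fun x (_ : x ∈ spectrum ℝ a) => (‖x‖₊ : ENNReal)) y hy
    rw [← ENNReal.ofReal_le_ofReal_iff', ← h, ← Real.norm_eq_abs, ofReal_norm, enorm_eq_nnnorm]
    exact this
  have hμ0 : 0 ≤ μ := by
    rcases key μ hμ with h | h
    · exact (abs_nonneg μ).trans h
    · exact (abs_nonpos_iff.1 h).ge
  exact (key x hx).elim id fun h => h.trans hμ0

section Nonneg

variable {W : Type*} [Fintype W] (B : SimpleGraph W) [DecidableRel B.Adj] (o : W) (k : ℕ) {α : ℝ}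

theorem betheDiag_nonneg (hα : 0 ≤ α) (a : ℕ) : 0 ≤ betheDiag B o k α a := by
  rw [betheDiag]
  split_ifs <;> positivity

theorem betheCodiag_nonneg (hα : α < 1) (a : ℕ) : 0 ≤ betheCodiag B o k α a := by
  have : 0 ≤ 1 - α := by linarith
  rw [betheCodiag]
  split_ifs <;> positivity

theorem betheT_nonneg (hα0 : 0 ≤ α) (hα1 : α < 1) (j : ℕ) (a b : Fin j) :
    0 ≤ betheT B o k α j a b := by
  simp only [betheT, of_apply]
  split_ifs
  · exact betheDiag_nonneg B o k hα0 _
  · exact betheCodiag_nonneg B o k hα1 _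
  · exact betheCodiag_nonneg B o k hα1 _
  · exact le_rfl

theorem abs_betheS_le (hα0 : 0 ≤ α) (hα1 : α < 1) {ρ ρ' : ℝ} (hρ : |ρ| ≤ ρ') (a b : Fin k) :
    |betheS B o k α ρ a b| ≤ betheS B o k α ρ' a b := by
  simp only [betheS, Matrix.add_apply, of_apply]
  refine (abs_add_le _ _).trans (add_le_add (abs_of_nonneg
    (betheT_nonneg B o k hα0 hα1 k a b)).le ?_)
  split_ifs
  · exact hρ
  · simp

theorem abs_betheT_le (hα0 : 0 ≤ α) (hα1 : α < 1) {ρ : ℝ} (hρ : 0 ≤ ρ) {j : ℕ} (hj : j ≤ k)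
    (a b : Fin j) : |betheT B o k α j a b| ≤
      (betheS B o k α ρ).submatrix (Fin.castLE hj) (Fin.castLE hj) a b := by
  rw [abs_of_nonneg (betheT_nonneg B o k hα0 hα1 j a b)]
  have : betheT B o k α j a b = betheT B o k α k (Fin.castLE hj a) (Fin.castLE hj b) := rfl
  rw [submatrix_apply, betheS, Matrix.add_apply, ← this, of_apply]
  refine le_add_of_nonneg_right ?_
  split_ifs
  · exact hρ
  · exact le_rfl

end Nonneg

theorem eigMult_copiesGraph {V W : Type*} [Fintype V] [DecidableEq V] [Fintype W] [DecidableEq W]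
    {R : SimpleGraph V} [DecidableRel R.Adj] {B : SimpleGraph W} [DecidableRel B.Adj] {o : W}
    {k : ℕ} (hB : IsGeneralizedBetheTree B o k) (α : ℝ) {r : ℕ}
    (hr : Fintype.card V = r) (ρ : Fin r → ℝ)
    (hρ : (alphaMatrix R α).charpoly = ∏ i, (X - C (ρ i))) (x : ℝ) :
    eigMult (alphaMatrix (copiesGraph R B o) α) x =
      ∑ j ∈ Finset.Ico 1 k, r * (betheNum B o k j - betheNum B o k (j + 1)) *
        eigMult (betheT B o k α j) x + ∑ i, eigMult (betheS B o k α (ρ i)) x := by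
  have hT : ∀ j ∈ Finset.Ico 1 k, (betheT B o k α j).charpoly ^
      (r * (betheNum B o k j - betheNum B o k (j + 1))) ≠ 0 :=
    fun j _ => pow_ne_zero _ (charpoly_monic _).ne_zero
  have hS : ∀ i ∈ Finset.univ, (betheS B o k α (ρ i)).charpoly ≠ 0 :=
    fun i _ => (charpoly_monic _).ne_zero
  rw [eigMult, charpoly_copiesGraph hB α hr ρ hρ, rootMultiplicity_mul
    (mul_ne_zero (Finset.prod_ne_zero_iff.2 hT) (Finset.prod_ne_zero_iff.2 hS)),
    rootMultiplicity_prod _ _ hT, rootMultiplicity_prod _ _ hS]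
  simp only [rootMultiplicity_pow', eigMult]

end

theorem mainTheorem2 {V W : Type*} [Fintype V] [DecidableEq V] [Fintype W] [DecidableEq W]
    (R : SimpleGraph V) [DecidableRel R.Adj] (hR : R.Connected)
    (r : ℕ) [NeZero r] (hr : Fintype.card V = r)
    (B : SimpleGraph W) [DecidableRel B.Adj] (o : W) (k : ℕ)
    (hB : IsGeneralizedBetheTree B o k)
    (α : ℝ) (hα0 : 0 ≤ α) (hα1 : α < 1)
    (ρ : Fin r → ℝ)
    (hρ : (alphaMatrix R α).charpoly = ∏ i, (Polynomial.X - Polynomial.C (ρ i)))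
    (hρ0 : spectralRadius ℝ (alphaMatrix R α) = ENNReal.ofReal (ρ 0)) :
    -- (1) the spectrum, as a set
    (spectrum ℝ (alphaMatrix (copiesGraph R B o) α) =
      (⋃ j ∈ {j : ℕ | 1 ≤ j ∧ j < k ∧ betheNum B o k (j + 1) < betheNum B o k j},
        spectrum ℝ (betheT B o k α j)) ∪
      ⋃ i : Fin r, spectrum ℝ (betheS B o k α (ρ i))) ∧
    -- (2) multiplicities: the eigenvalues of each matrix are simple, those of `T_j` contribute
    -- `r (n_j - n_{j+1})`, those of `S_i` contribute `1`, and the contributions are added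
    (∀ j, 1 ≤ j → j < k → ∀ x ∈ spectrum ℝ (betheT B o k α j), eigMult (betheT B o k α j) x = 1) ∧
    (∀ i, ∀ x ∈ spectrum ℝ (betheS B o k α (ρ i)), eigMult (betheS B o k α (ρ i)) x = 1) ∧
    (∀ x : ℝ, (eigMult (alphaMatrix (copiesGraph R B o) α) x : ℤ) =
      (∑ j ∈ Finset.Ico 1 k, ((r : ℤ) * ((betheNum B o k j : ℤ) - (betheNum B o k (j + 1) : ℤ))) *
        (eigMult (betheT B o k α j) x : ℤ)) +
      ∑ i : Fin r, (eigMult (betheS B o k α (ρ i)) x : ℤ)) ∧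
    -- (3) the spectral radius is the largest eigenvalue of `S_1`
    (∃ μ : ℝ, IsGreatest (spectrum ℝ (betheS B o k α (ρ 0))) μ ∧ 0 ≤ μ ∧
      spectralRadius ℝ (alphaMatrix (copiesGraph R B o) α) = ENNReal.ofReal μ) := by
  have hmult := eigMult_copiesGraph hB α hr ρ hρ
  have hspec : ∀ x, x ∈ spectrum ℝ (alphaMatrix (copiesGraph R B o) α) ↔
      (∃ j, (1 ≤ j ∧ j < k ∧ betheNum B o k (j + 1) < betheNum B o k j) ∧
        x ∈ spectrum ℝ (betheT B o k α j)) ∨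
      ∃ i, x ∈ spectrum ℝ (betheS B o k α (ρ i)) := by
    intro x
    rw [mem_spectrum_iff_eigMult_pos, hmult x, Nat.add_pos_iff_pos_or_pos, Finset.sum_pos_iff,
      Finset.sum_pos_iff]
    simp only [mem_spectrum_iff_eigMult_pos, CanonicallyOrderedAdd.mul_pos, Finset.mem_Ico,
      tsub_pos_iff_lt, Nat.pos_of_neZero r, true_and, Finset.mem_univ, and_assoc]
  have hcod : ∀ a, a + 1 < k → betheCodiag B o k α a ≠ 0 := fun a ha =>
    hB.betheCodiag_ne_zero hα1 ha
  refine ⟨?_, ?_, ?_, ?_, ?_⟩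
  · ext x
    rw [hspec]
    simp only [Set.mem_union, Set.mem_iUnion, Set.mem_ofPred_eq, exists_prop]
  · intro j _ hjk x hx
    rw [betheT_eq_tridiag] at hx ⊢
    exact tridiag_rootMultiplicity _ _ _ (fun a ha => hcod a (by omega)) x hx
  · intro i x hx
    rw [betheS_eq_tridiag] at hx ⊢
    exact tridiag_rootMultiplicity _ _ _ hcod x hx
  · intro x
    rw [hmult x]
    push_cast
    congr 1
    refine Finset.sum_congr rfl fun j hj => ?_
    -- Since `n_{j+1} ≤ n_j`, the natural-number subtraction is not truncated.
    rw [Nat.cast_sub (hB.betheNum_succ_le (Finset.mem_Ico.1 hj).1)]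
  · have hρmem : ∀ i, ρ i ∈ spectrum ℝ (alphaMatrix R α) := fun i => by
      rw [Matrix.mem_spectrum_iff_isRoot_charpoly, hρ, Polynomial.IsRoot.def,
        Polynomial.eval_prod]
      exact Finset.prod_eq_zero (Finset.mem_univ i) (by simp)
    have hρle : ∀ i, |ρ i| ≤ ρ 0 := fun i =>
      abs_le_of_spectralRadius_eq (hρmem 0) hρ0 (hρmem i)
    have hS : (betheS B o k α (ρ 0)).IsHermitian := by
      rw [betheS_eq_tridiag]
      exact tridiag_isHermitian _ _ _
    have : Nonempty (Fin k) := ⟨⟨0, (Nat.zero_le _).trans_lt (hB.dist_lt o)⟩⟩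
    obtain ⟨i₀, hi₀⟩ := Finite.exists_max hS.eigenvalues
    set μ := hS.eigenvalues i₀ with hμ
    have hmem : μ ∈ spectrum ℝ (betheS B o k α (ρ 0)) := hS.eigenvalues_mem_spectrum_real i₀
    have hub : ∀ y ∈ spectrum ℝ (betheS B o k α (ρ 0)), y ≤ μ := fun y hy => by
      rw [hS.spectrum_real_eq_range_eigenvalues] at hy
      obtain ⟨i, rfl⟩ := hy
      exact hi₀ i
    have hpsd := posSemidef_smul_one_sub hS hub
    have hSle : ∀ i, ∀ x ∈ spectrum ℝ (betheS B o k α (ρ i)), |x| ≤ μ := fun i x hx =>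
      abs_le_of_mem_spectrum_of_abs_le hpsd (abs_betheS_le B o k hα0 hα1 (hρle i)) hx
    have hTle : ∀ j, j < k → ∀ x ∈ spectrum ℝ (betheT B o k α j), |x| ≤ μ := by
      intro j hj x hx
      refine abs_le_of_mem_spectrum_of_abs_le (M := (betheS B o k α (ρ 0)).submatrix
        (Fin.castLE hj.le) (Fin.castLE hj.le)) ?_
        (abs_betheT_le B o k hα0 hα1 ((abs_nonneg _).trans (hρle 0)) hj.le) hx
      -- `T_j` is compared with a leading principal submatrix of `S_1`, for which `μ` minus it is
      -- still positive semidefinite.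
      convert hpsd.submatrix (Fin.castLE hj.le) using 1
      ext a b
      simp [Matrix.algebraMap_matrix_apply]
    refine ⟨μ, ⟨hmem, hub⟩, (abs_nonneg μ).trans (hSle 0 μ hmem),
      spectralRadius_eq_ofReal ((hspec μ).2 (Or.inr ⟨0, hmem⟩)) fun x hx => ?_⟩
    rcases (hspec x).1 hx with ⟨j, hj, hxj⟩ | ⟨i, hxi⟩
    · exact hTle j hj.2.1 x hxj
    · exact hSle i x hxi
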